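/- Let $k$ be an algebraically closed field of characteristic zero, let $V$ be a finite-dimensional $k$-vector space with basis $e_1,\dots,e_n$, let $R=\operatorname{Sym}(V^*)$, and let $x_1,\dots,x_n\in V^*\subseteq R$ be the dual basis. For $P\in V$ let $\mathfrak m_P\subseteq R$ be the maximal ideal of $P$, generated by $z_i=x_i-x_i(P)$, and let $$\operatorname{LC}(V,P)=H^n_{\mathfrak m_P}(R,\Omega^n_{R/k})=\varinjlim_t\ \Omega^n_{R/k}/(z_1^{t+1},\dots,z_n^{t+1})\Omega^n_{R/k}$$ (transition maps: multiplication by powers of $z_1\cdots z_n$) be the module of generalised fractions $\left[\frac{\omega}{z_1^{t+1},\dots,z_n^{t+1}}\right]$. The residue $\operatorname{Res}_P:\operatorname{LC}(V,P)\to k$ sends $\left[\frac{f\,dz_1\wedge\cdots\wedge dz_n}{z_1^{t+1},\dots,z_n^{t+1}}\right]$ to the coefficient of $z_1^t\cdots z_n^t$ in the Taylor expansion of $f$ at $P$. The space $\operatorname{LC}(V,P)$ has the basis $\xi_a=\left[\frac{dz_1\wedge\cdots\wedge dz_n}{z_1^{a_1+1},\dots,z_n^{a_n+1}}\right]$, $a\in\mathbb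 N^n$, and it is a cocommutative $k$-coalgebra with coproduct $\Delta\xi_a=\sum_{c+d=a}\xi_c\otimes\xi_d$ and counit $\operatorname{Res}_P$. Let $!V=\bigoplus_{P\in V}\operatorname{LC}(V,P)$ be the direct sum of these $R$-modules and coalgebras, with $\operatorname{Res}=\sum_P\operatorname{Res}_P:{!}V\to k$, and let $d:{!}V\to V$ be the linear map $d(\omega)=\sum_{i}\operatorname{Res}(x_i\omega)\,e_i$. Let $C$ be a (coassociative, counital) cocommutative $k$-coalgebra with coproduct $\Delta$ and counit $\varepsilon$, and let $\phi:C\to V$ be a linear map. Write $\Delta^{-1}=\varepsilon$, $\Delta^0=\operatorname{id}$ and $\Delta^{l}=(\Delta^{l-1}\otimes\operatorname{id})\Delta:C\to C^{\otimes(l+1)}$. For $\eta\in C$ the sequence $$\sum_{l\ge-1}\phi^{\otimes(l+1)}\Delta^l(\eta)=\big(\varepsilon(\eta),\ \phi(\eta),\ \phi^{\otimes2}\Delta(\eta),\ \dots\big)\in\prod_{l\ge0}(V^{\otimes l})^{\mathfrak S_l}$$ consists of symmetric tensors. For $f\in\operatorname{Sym}(V^*)$ and a sequence $t=(t_l)_{l\ge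 0}$ of symmetric tensors let $f\lrcorner\, t\in k$ be the contraction: it is linear in $f$, and $(\kappa_1\cdots\kappa_q)\lrcorner\, t=\langle\kappa_1\otimes\cdots\otimes\kappa_q,\ t_q\rangle$ for $\kappa_1,\dots,\kappa_q\in V^*$, where $\langle\kappa_1\otimes\cdots\otimes\kappa_q,v_1\otimes\cdots\otimes v_q\rangle=\kappa_1(v_1)\cdots\kappa_q(v_q)$. Then there is a unique morphism of coalgebras $\Phi:C\to{!}V$ with $d\circ\Phi=\phi$, and for every $\eta\in C$ the element $\Phi(\eta)$ is the unique element of $!V$ with the property that $$\operatorname{Res}(f\,\Phi(\eta))=f\ \lrcorner\ \sum_{l\ge-1}\phi^{\otimes(l+1)}\Delta^l(\eta)\qquad\text{for every } f\in\operatorname{Sym}(V^*).$$ -/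

import Mathlib

open scoped TensorProduct DirectSum

noncomputable section

namespace CofreeCoalg

section TopLocalCohomology

variable {R : Type*} [CommRing R] {n : ℕ}

/-- The ideal `(z_1^(t+1), …, z_n^(t+1))`. -/
def denomIdeal (z : Fin n → R) (t : ℕ) : Ideal R :=
  Ideal.span (Set.range fun i => z i ^ (t + 1))

/-- The quotient `M / (z_1^(t+1), …, z_n^(t+1)) M`. -/
abbrev Level (z : Fin n → R) (M : Type*) [AddCommGroup M] [Module R M] (t : ℕ) : Type _ :=
  M ⧸ (denomIdeal z t • (⊤ : Submodule R M))

variable (z : Fin n → R) (M : Type*) [AddCommGroup M] [Module R M]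

theorem smul_mem_denom {t s : ℕ} (h : t ≤ s) (m : M)
    (hm : m ∈ denomIdeal z t • (⊤ : Submodule R M)) :
    ((∏ i, z i) ^ (s - t)) • m ∈ denomIdeal z s • (⊤ : Submodule R M) := by
  refine Submodule.smul_induction_on hm (fun r hr x _ => ?_) (fun x y hx hy => ?_)
  · rw [smul_smul]
    refine Submodule.smul_mem_smul ?_ trivial
    refine Submodule.span_induction (p := fun r _ => (∏ i, z i) ^ (s - t) * r ∈ denomIdeal z s)
      ?_ ?_ ?_ ?_ hr
    · rintro _ ⟨i, rfl⟩
      have h1 : z i ^ (s + 1) ∣ (∏ i, z i) ^ (s - t) * z i ^ (t + 1) := by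
        have : s + 1 = (s - t) + (t + 1) := by omega
        rw [this, pow_add]
        exact mul_dvd_mul (pow_dvd_pow_of_dvd (Finset.dvd_prod_of_mem _ (Finset.mem_univ i)) _)
          dvd_rfl
      exact Ideal.mem_of_dvd _ h1 (Ideal.subset_span ⟨i, rfl⟩)
    · simp
    · intro x y _ _ hx hy
      rw [mul_add]; exact add_mem hx hy
    · intro a x _ hx
      rw [smul_eq_mul, mul_left_comm]; exact Ideal.mul_mem_left _ _ hx
  · rw [smul_add]; exact add_mem hx hy

/-- The map `M / (z_1^(t+1), …, z_n^(t+1)) M → M / (z_1^(s+1), …, z_n^(s+1)) M` for `t ≤ s` given by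
multiplication by `(z_1 ⋯ z_n)^(s-t)`. -/
def transition (t s : ℕ) (h : t ≤ s) : Level z M t →ₗ[R] Level z M s :=
  Submodule.mapQ _ _ (((∏ i, z i) ^ (s - t)) • LinearMap.id)
    (fun m hm => by simpa using smul_mem_denom z M h m hm)

/-- The top local cohomology module `H^n_I(M)` with support in `I = (z_1, …, z_n)`, presented as the
direct limit of the quotients `M / (z_1^(t+1), …, z_n^(t+1)) M` along multiplication by powers of
`z_1 ⋯ z_n`, that is, as the module of generalised fractions with denominators `z_1^(t+1), …,
z_n^(t+1)`, equivalently the cokernel in the last degree of the Čech complex of `z_1, …, z_n`. -/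
def TopLocalCohomology : Type _ := Module.DirectLimit (Level z M) (transition z M)

instance : AddCommGroup (TopLocalCohomology z M) :=
  inferInstanceAs (AddCommGroup (Module.DirectLimit (Level z M) (transition z M)))

instance : Module R (TopLocalCohomology z M) :=
  inferInstanceAs (Module R (Module.DirectLimit (Level z M) (transition z M)))

variable {M} in
/-- The generalised fraction `[m / z_1^(t+1), …, z_n^(t+1)]`. -/
def frac (t : ℕ) : M →ₗ[R] TopLocalCohomology z M :=
  (show Level z M t →ₗ[R] TopLocalCohomology z M from
    Module.DirectLimit.of R ℕ (Level z M) (transition z M) t) ∘ₗ Submodule.mkQ _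

variable {M}

theorem exists_frac (x : TopLocalCohomology z M) : ∃ t m, frac z t m = x := by
  obtain ⟨t, y, rfl⟩ := Module.DirectLimit.exists_of (R := R) (f := transition z M) x
  obtain ⟨m, rfl⟩ := Submodule.Quotient.mk_surjective _ y
  exact ⟨t, m, rfl⟩

theorem frac_of_le {t s : ℕ} (h : t ≤ s) (m : M) :
    frac z s (((∏ i, z i) ^ (s - t)) • m) = frac z t m :=
  Module.DirectLimit.of_f (R := R) (f := transition z M) (hij := h) (x := Submodule.Quotient.mk m)

theorem frac_eq_zero {t : ℕ} {m : M} (hm : m ∈ denomIdeal z t • (⊤ : Submodule R M)) :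
    frac z t m = 0 := by
  rw [frac, LinearMap.comp_apply, Submodule.mkQ_apply, (Submodule.Quotient.mk_eq_zero _).2 hm,
    map_zero]

/-- Auxiliary: an additive map on `M` that kills the denominators descends to `Level z M t`. -/
def levelHom {A : Type*} [AddCommGroup A] (g : ℕ → M →+ A)
    (h0 : ∀ t, ∀ m ∈ denomIdeal z t • (⊤ : Submodule R M), g t m = 0) (t : ℕ) :
    Level z M t →+ A :=
  QuotientAddGroup.lift (denomIdeal z t • (⊤ : Submodule R M)).toAddSubgroup (g t) (h0 t)

/-- Additive maps out of `TopLocalCohomology z M`, specified on generalised fractions. -/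
def liftAdd {A : Type*} [AddCommGroup A] (g : ℕ → M →+ A)
    (h0 : ∀ t, ∀ m ∈ denomIdeal z t • (⊤ : Submodule R M), g t m = 0)
    (hg : ∀ t s, t ≤ s → ∀ m, g s (((∏ i, z i) ^ (s - t)) • m) = g t m) :
    TopLocalCohomology z M →+ A :=
  AddCon.lift (Module.DirectLimit.moduleCon (transition z M)).toAddCon
    (DirectSum.toAddMonoid (levelHom z g h0)) <|
    AddCon.addConGen_le.2 fun _ _ ⟨h, x⟩ => by
      induction x using Submodule.Quotient.induction_on with
      | _ m =>
        rw [AddCon.ker_rel, DirectSum.lof_eq_of, DirectSum.lof_eq_of, DirectSum.toAddMonoid_of,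
          DirectSum.toAddMonoid_of]
        exact (hg _ _ h m).symm

theorem liftAdd_frac {A : Type*} [AddCommGroup A] (g : ℕ → M →+ A) (h0) (hg) (t : ℕ) (m : M) :
    liftAdd z g h0 hg (frac z t m) = g t m := by
  change DirectSum.toAddMonoid (levelHom z g h0)
    (DirectSum.lof R ℕ (Level z M) t (Submodule.Quotient.mk m)) = _
  rw [DirectSum.lof_eq_of, DirectSum.toAddMonoid_of]
  rfl

end TopLocalCohomology

section Poly

variable {k : Type*} [Field k] {V : Type*} [AddCommGroup V] [Module k V]

variable (k V) in
/-- The ring `R = Sym(V^*)` of polynomial functions on `V`. -/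
abbrev PolyRing : Type _ := SymmetricAlgebra k (Module.Dual k V)

variable {n : ℕ} (b : Module.Basis (Fin n) k V)

/-- The coordinate function `x_i = e_i^*` in `R`. -/
def coordFn (i : Fin n) : PolyRing k V := SymmetricAlgebra.ι k _ (b.coord i)

/-- The local parameter `z_i = x_i - P_i` at the point `P`. -/
def localParam (P : V) (i : Fin n) : PolyRing k V :=
  coordFn b i - algebraMap k (PolyRing k V) (b.coord i P)

/-- Evaluation of polynomial functions at `P`; its kernel is the maximal ideal `m_P`. -/
def evalAt (P : V) : PolyRing k V →ₐ[k] k := SymmetricAlgebra.lift (Module.Dual.eval k V P)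

/-- The Taylor expansion `f ↦ f(P + ∑_i X_i e_i)` of a polynomial function at `P`; it sends `z_i`
to `X_i`. -/
def taylor (P : V) : PolyRing k V →ₐ[k] MvPolynomial (Fin n) k :=
  SymmetricAlgebra.lift
    ((∑ i, LinearMap.toSpanSingleton k _ (MvPolynomial.X i) ∘ₗ Module.Dual.eval k V (b i)) +
      Algebra.linearMap k _ ∘ₗ Module.Dual.eval k V P)

theorem taylor_localParam (P : V) (i : Fin n) :
    taylor b P (localParam b P i) = MvPolynomial.X i := by
  simp [taylor, localParam, coordFn, Finsupp.single_apply, ite_smul]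

/-- The partial derivative `∂/∂x_j` on `R`. -/
def partialDeriv (j : Fin n) : Derivation k (PolyRing k V) (PolyRing k V) :=
  let e : PolyRing k V ≃ₐ[k] MvPolynomial (Fin n) k :=
    SymmetricAlgebra.equivMvPolynomial b.dualBasis
  Derivation.mk' (e.symm.toLinearMap ∘ₗ (MvPolynomial.pderiv j).toLinearMap ∘ₗ e.toLinearMap)
    (fun f g => by simp [Derivation.leibniz])

theorem partialDeriv_coordFn (i j : Fin n) :
    partialDeriv b j (coordFn b i) = if i = j then 1 else 0 := by
  have h : SymmetricAlgebra.equivMvPolynomial b.dualBasis (coordFn b i) = MvPolynomial.X i := by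
    have := SymmetricAlgebra.equivMvPolynomial_ι_apply b.dualBasis i
    rwa [Module.Basis.coe_dualBasis] at this
  change (SymmetricAlgebra.equivMvPolynomial b.dualBasis).symm
    (MvPolynomial.pderiv j (SymmetricAlgebra.equivMvPolynomial b.dualBasis (coordFn b i))) = _
  rw [h, MvPolynomial.pderiv_X, Pi.single_apply]
  split_ifs <;> simp

theorem coordFn_expand (κ : Module.Dual k V) :
    SymmetricAlgebra.ι k _ κ = ∑ i, κ (b i) • coordFn b i := by
  simp only [coordFn, ← map_smul, ← map_sum]
  congr 1
  refine b.ext fun j => ?_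
  simp

/-- The local parameters at `P` generate the maximal ideal of `P`. -/
theorem span_localParam (P : V) :
    Ideal.span (Set.range (localParam b P)) = RingHom.ker (evalAt (k := k) P) := by
  apply le_antisymm
  · rw [Ideal.span_le]
    rintro _ ⟨i, rfl⟩
    simp [RingHom.mem_ker, evalAt, localParam, coordFn]
  · intro f hf
    have key : ∀ f : PolyRing k V, f - algebraMap k (PolyRing k V) (evalAt P f) ∈
        Ideal.span (Set.range (localParam b P)) := by
      intro f
      induction f using SymmetricAlgebra.induction with
      | algebraMap r => simp
      | ι κ =>
        rw [coordFn_expand b κ, map_sum, map_sum, ← Finset.sum_sub_distrib]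
        refine sum_mem fun i _ => ?_
        have : κ (b i) • coordFn b i - algebraMap k (PolyRing k V)
            (evalAt P (κ (b i) • coordFn b i)) = κ (b i) • localParam b P i := by
          simp [evalAt, localParam, coordFn, mul_sub, Algebra.smul_def]
        rw [this]
        exact Submodule.smul_of_tower_mem _ _ (Ideal.subset_span ⟨i, rfl⟩)
      | mul f g hf hg =>
        have : f * g - algebraMap k (PolyRing k V) (evalAt P (f * g)) =
            f * (g - algebraMap k (PolyRing k V) (evalAt P g)) +
            algebraMap k (PolyRing k V) (evalAt P g) *
              (f - algebraMap k (PolyRing k V) (evalAt P f)) := by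
          rw [map_mul, map_mul]; ring
        rw [this]
        exact add_mem (Ideal.mul_mem_left _ _ hg) (Ideal.mul_mem_left _ _ hf)
      | add f g hf hg =>
        rw [map_add, map_add, add_sub_add_comm]; exact add_mem hf hg
    have h := key f
    rwa [(RingHom.mem_ker).1 hf, map_zero, sub_zero] at h

theorem D_coordFn_span :
    Submodule.span (PolyRing k V) (Set.range fun i =>
      KaehlerDifferential.D k (PolyRing k V) (coordFn b i)) = ⊤ := by
  rw [eq_top_iff, ← KaehlerDifferential.span_range_derivation, Submodule.span_le]
  rintro _ ⟨f, rfl⟩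
  induction f using SymmetricAlgebra.induction with
  | algebraMap r => simp
  | ι κ =>
    rw [coordFn_expand b κ, map_sum]
    refine sum_mem fun i _ => ?_
    rw [Derivation.map_smul]
    exact Submodule.smul_of_tower_mem _ _ (Submodule.subset_span ⟨i, rfl⟩)
  | mul f g hf hg =>
    rw [Derivation.leibniz]
    exact add_mem (Submodule.smul_mem _ _ hg) (Submodule.smul_mem _ _ hf)
  | add f g hf hg => rw [map_add]; exact add_mem hf hg

theorem D_coordFn_linearIndependent :
    LinearIndependent (PolyRing k V) (fun i =>
      KaehlerDifferential.D k (PolyRing k V) (coordFn b i)) :=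
  LinearIndependent.of_pairwise_dual_eq_zero_one _
    (fun j => (partialDeriv b j).liftKaehlerDifferential)
    (fun i j h => by simp [partialDeriv_coordFn, h.symm]) (fun i => by simp [partialDeriv_coordFn])

/-- The differentials `dx_1, …, dx_n` form a basis of the Kähler differentials of `R`. -/
def diffBasis : Module.Basis (Fin n) (PolyRing k V) Ω[PolyRing k V⁄k] :=
  Module.Basis.mk (D_coordFn_linearIndependent b) (D_coordFn_span b).ge

theorem diffBasis_apply (i : Fin n) :
    diffBasis b i = KaehlerDifferential.D k (PolyRing k V) (coordFn b i) := by
  simp [diffBasis]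

variable (k V) in
/-- The module `Ω^n` of `n`-forms on `R = Sym(V^*)`. -/
abbrev Forms (n : ℕ) : Type _ := ⋀[PolyRing k V]^n Ω[PolyRing k V⁄k]

/-- The form `dz_1 ∧ ⋯ ∧ dz_n`. -/
def volForm (P : V) : Forms k V n :=
  exteriorPower.ιMulti (PolyRing k V) n fun i =>
    KaehlerDifferential.D k (PolyRing k V) (localParam b P i)

theorem volForm_eq (P : V) : volForm b P = exteriorPower.ιMulti (PolyRing k V) n (diffBasis b) := by
  unfold volForm
  congr 1
  funext i
  simp [diffBasis_apply, localParam]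

/-- The coefficient `f` of the top form `f dx_1 ∧ ⋯ ∧ dx_n = f dz_1 ∧ ⋯ ∧ dz_n`. -/
def formCoeff : Forms k V n →ₗ[PolyRing k V] PolyRing k V :=
  exteriorPower.alternatingMapLinearEquiv (diffBasis b).det

theorem formCoeff_volForm (P : V) : formCoeff b (volForm b P) = 1 := by
  rw [volForm_eq, formCoeff, exteriorPower.alternatingMapLinearEquiv_apply_ιMulti,
    Module.Basis.det_self]

theorem formCoeff_smul_volForm (P : V) (ω : Forms k V n) : formCoeff b ω • volForm b P = ω := by
  have : (LinearMap.toSpanSingleton (PolyRing k V) _ (volForm b P)) ∘ₗ formCoeff b =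
      LinearMap.id := by
    refine exteriorPower.linearMap_ext (Module.Basis.ext_alternating (diffBasis b) ?_)
    intro v hv
    obtain ⟨σ, rfl⟩ : ∃ σ : Equiv.Perm (Fin n), ⇑σ = v :=
      ⟨Equiv.ofBijective v (Finite.injective_iff_bijective.1 hv), rfl⟩
    have h1 := AlternatingMap.map_perm (exteriorPower.ιMulti (PolyRing k V) n) (diffBasis b) σ
    have h2 : (fun i => diffBasis b (σ i)) = ⇑(diffBasis b) ∘ σ := rfl
    simp only [LinearMap.compAlternatingMap_apply, LinearMap.comp_apply, LinearMap.id_apply, h2, h1]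
    rw [← volForm_eq b P, map_zsmul_unit, map_zsmul_unit, formCoeff_volForm]
    simp
  exact congrArg (fun L => L ω) this

/-- `LC(V, P) = H^n_{m_P}(Sym(V^*), Ω^n)`, where the maximal ideal `m_P` of `P` is generated by the
local parameters `z_1, …, z_n`. -/
def LC (P : V) : Type _ := TopLocalCohomology (localParam b P) (Forms k V n)

variable (P : V)

instance : AddCommGroup (LC b P) :=
  inferInstanceAs (AddCommGroup (TopLocalCohomology (localParam b P) (Forms k V n)))

instance : Module (PolyRing k V) (LC b P) :=
  inferInstanceAs (Module (PolyRing k V) (TopLocalCohomology (localParam b P) (Forms k V n)))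

instance : Module k (LC b P) := Module.compHom _ (algebraMap k (PolyRing k V))

instance : IsScalarTower k (PolyRing k V) (LC b P) :=
  ⟨fun c f x => by rw [Algebra.smul_def, mul_smul]; rfl⟩

/-- The generalised fraction `[ω / z_1^(t+1), …, z_n^(t+1)]`. -/
def LC.frac (t : ℕ) : Forms k V n →ₗ[PolyRing k V] LC b P :=
  CofreeCoalg.frac (localParam b P) t

theorem LC.exists_frac (x : LC b P) : ∃ t ω, LC.frac b P t ω = x :=
  CofreeCoalg.exists_frac (localParam b P) x

/-- The exponent `(t, …, t)`. -/
def diagExp (n t : ℕ) : Fin n →₀ ℕ := Finsupp.equivFunOnFinite.symm fun _ => t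

/-- The coefficient of `z_1^t ⋯ z_n^t` in the Taylor expansion at `P` of the coefficient of `ω`. -/
def resLevel (t : ℕ) : Forms k V n →+ k :=
  ((MvPolynomial.lcoeff k (diagExp n t)).toAddMonoidHom.comp
    (taylor b P).toLinearMap.toAddMonoidHom).comp (formCoeff b).toAddMonoidHom

theorem resLevel_apply (t : ℕ) (ω : Forms k V n) :
    resLevel b P t ω = MvPolynomial.coeff (diagExp n t) (taylor b P (formCoeff b ω)) := rfl

theorem X_prod_pow (m : ℕ) :
    (∏ i : Fin n, (MvPolynomial.X i : MvPolynomial (Fin n) k)) ^ m =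
      MvPolynomial.monomial (diagExp n m) 1 := by
  rw [MvPolynomial.monomial_eq, Finsupp.prod_fintype _ _ (by simp), ← Finset.prod_pow]
  simp [diagExp]

theorem resLevel_zero (t : ℕ) (ω : Forms k V n)
    (h : ω ∈ denomIdeal (localParam b P) t • (⊤ : Submodule (PolyRing k V) (Forms k V n))) :
    resLevel b P t ω = 0 := by
  refine Submodule.smul_induction_on h (fun r hr x _ => ?_) (fun x y hx hy => ?_)
  · refine Submodule.span_induction (p := fun r _ => ∀ x, resLevel b P t (r • x) = 0)
      ?_ ?_ ?_ ?_ hr x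
    · rintro _ ⟨i, rfl⟩ x
      rw [resLevel_apply, map_smul, smul_eq_mul, map_mul, map_pow, taylor_localParam,
        MvPolynomial.X_pow_eq_monomial, MvPolynomial.coeff_monomial_mul', if_neg]
      intro hle
      have := hle i
      simp [diagExp] at this
    · simp
    · intro r s _ _ hr hs x
      rw [add_smul, map_add, hr, hs, add_zero]
    · intro a r _ hr x
      rw [smul_eq_mul, mul_comm, mul_smul]; exact hr _
  · rw [map_add, hx, hy, add_zero]

theorem resLevel_compat (t s : ℕ) (h : t ≤ s) (ω : Forms k V n) :
    resLevel b P s (((∏ i, localParam b P i) ^ (s - t)) • ω) = resLevel b P t ω := by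
  have : diagExp n s = diagExp n (s - t) + diagExp n t := by
    ext i; simp [diagExp]; omega
  rw [resLevel_apply, map_smul, smul_eq_mul, map_mul, map_pow, map_prod]
  simp only [taylor_localParam]
  rw [X_prod_pow, this, MvPolynomial.coeff_monomial_mul, one_mul, resLevel_apply]

/-- The residue `Res_P : LC(V, P) → k`, sending `[f dz_1 ∧ ⋯ ∧ dz_n / z_1^(t+1), …, z_n^(t+1)]` to
the coefficient of `z_1^t ⋯ z_n^t` in the Taylor expansion of `f` at `P`. -/
def res : LC b P →ₗ[k] k where
  __ := liftAdd (localParam b P) (resLevel b P) (resLevel_zero b P) (resLevel_compat b P)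
  map_smul' c x := by
    obtain ⟨t, ω, rfl⟩ := LC.exists_frac b P x
    change liftAdd (localParam b P) (resLevel b P) (resLevel_zero b P) (resLevel_compat b P)
        (algebraMap k (PolyRing k V) c • CofreeCoalg.frac (localParam b P) t ω) =
      c • liftAdd (localParam b P) (resLevel b P) (resLevel_zero b P) (resLevel_compat b P)
        (CofreeCoalg.frac (localParam b P) t ω)
    rw [← map_smul (CofreeCoalg.frac (localParam b P) t), liftAdd_frac, liftAdd_frac, resLevel_apply,
      resLevel_apply, map_smul, smul_eq_mul, map_mul, AlgHom.commutes, MvPolynomial.algebraMap_eq, MvPolynomial.coeff_C_mul,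
      smul_eq_mul]

theorem res_frac (t : ℕ) (ω : Forms k V n) : res b P (LC.frac b P t ω) =
    MvPolynomial.coeff (diagExp n t) (taylor b P (formCoeff b ω)) :=
  liftAdd_frac (localParam b P) (resLevel b P) (resLevel_zero b P) (resLevel_compat b P) t ω

/-- The monomial `z_1^(a_1) ⋯ z_n^(a_n)`. -/
def monomialAt (a : Fin n →₀ ℕ) : PolyRing k V := ∏ i, localParam b P i ^ a i

theorem taylor_monomialAt (a : Fin n →₀ ℕ) : taylor b P (monomialAt b P a) = MvPolynomial.monomial a 1 := by
  rw [MvPolynomial.monomial_eq, Finsupp.prod_fintype _ _ (by simp), monomialAt, map_prod]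
  simp [taylor_localParam]

/-- The generalised fraction `[dz_1 ∧ ⋯ ∧ dz_n / z_1^(a_1+1), …, z_n^(a_n+1)]`, written with equal
exponents in the denominator. -/
def genFrac (a : Fin n →₀ ℕ) : LC b P :=
  LC.frac b P a.degree (monomialAt b P (diagExp n a.degree - a) • volForm b P)

theorem le_diagExp (a : Fin n →₀ ℕ) : a ≤ diagExp n a.degree :=
  fun i => Finsupp.le_degree i a

/-- `Res_P(f [dz / z^(a+1)])` is the coefficient of `z^a` in the Taylor expansion of `f` at `P`. -/
theorem res_smul_genFrac (f : PolyRing k V) (a : Fin n →₀ ℕ) :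
    res b P (f • genFrac b P a) = MvPolynomial.coeff a (taylor b P f) := by
  rw [genFrac, ← map_smul, res_frac, smul_smul, map_smul, formCoeff_volForm, smul_eq_mul, mul_one,
    map_mul, taylor_monomialAt]
  have h := MvPolynomial.coeff_mul_monomial a (diagExp n a.degree - a) (1 : k) (taylor b P f)
  rwa [add_tsub_cancel_of_le (le_diagExp a), mul_one] at h

theorem monomialAt_add (a c : Fin n →₀ ℕ) : monomialAt b P (a + c) = monomialAt b P a * monomialAt b P c := by
  simp [monomialAt, pow_add, Finset.prod_mul_distrib]

theorem prod_pow_eq_monomialAt (m : ℕ) : (∏ i, localParam b P i) ^ m = monomialAt b P (diagExp n m) := by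
  simp [monomialAt, diagExp, Finset.prod_pow]

theorem frac_monomialAt_of_le (a : Fin n →₀ ℕ) {t s : ℕ} (hts : t ≤ s) (h : a ≤ diagExp n t) :
    LC.frac b P s (monomialAt b P (diagExp n s - a) • volForm b P) =
      LC.frac b P t (monomialAt b P (diagExp n t - a) • volForm b P) := by
  have h1 : diagExp n s - a = diagExp n (s - t) + (diagExp n t - a) := by
    ext i
    have := h i
    simp [diagExp] at this ⊢
    omega
  rw [h1, monomialAt_add, ← prod_pow_eq_monomialAt, mul_smul]
  exact frac_of_le (localParam b P) hts _

theorem genFrac_eq (a : Fin n →₀ ℕ) (t : ℕ) (h : a ≤ diagExp n t) :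
    LC.frac b P t (monomialAt b P (diagExp n t - a) • volForm b P) = genFrac b P a := by
  rw [genFrac, ← frac_monomialAt_of_le b P a (le_max_left t a.degree) h,
    ← frac_monomialAt_of_le b P a (le_max_right t a.degree) (le_diagExp a)]

theorem frac_monomialAt_eq_zero (m : Fin n →₀ ℕ) (t : ℕ) (h : ¬ m ≤ diagExp n t) (ω : Forms k V n) :
    LC.frac b P t (monomialAt b P m • ω) = 0 := by
  obtain ⟨i, hi⟩ : ∃ i, t + 1 ≤ m i := by
    by_contra! hc
    exact h fun i => Nat.lt_succ_iff.1 (hc i)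
  refine frac_eq_zero (localParam b P) (Submodule.smul_mem_smul ?_ trivial)
  refine Ideal.mem_of_dvd _ ?_ (Ideal.subset_span ⟨i, rfl⟩)
  exact (pow_dvd_pow _ hi).trans (Finset.dvd_prod_of_mem _ (Finset.mem_univ i))

theorem monomialAt_span : Submodule.span k (Set.range (monomialAt b P)) = ⊤ := by
  have hone : (1 : PolyRing k V) ∈ Submodule.span k (Set.range (monomialAt b P)) :=
    Submodule.subset_span ⟨0, by simp [monomialAt]⟩
  rw [eq_top_iff]
  rintro f -
  induction f using SymmetricAlgebra.induction with
  | algebraMap r => rw [Algebra.algebraMap_eq_smul_one]; exact Submodule.smul_mem _ _ hone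
  | ι κ =>
    rw [coordFn_expand b κ]
    refine sum_mem fun i _ => Submodule.smul_mem _ _ ?_
    have : coordFn b i = localParam b P i + (b.coord i P) • 1 := by
      simp [localParam, Algebra.algebraMap_eq_smul_one]
    rw [this]
    refine add_mem (Submodule.subset_span ⟨Finsupp.single i 1, ?_⟩) (Submodule.smul_mem _ _ hone)
    rw [monomialAt, Finset.prod_eq_single i (fun j _ hj => by simp [hj.symm]) (by simp)]
    simp
  | mul f g hf hg =>
    have h := Submodule.mul_mem_mul hf hg
    rw [Submodule.span_mul_span] at h
    refine Submodule.span_mono ?_ h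
    rintro _ ⟨_, ⟨a, rfl⟩, _, ⟨c, rfl⟩, rfl⟩
    exact ⟨a + c, monomialAt_add b P a c⟩
  | add f g hf hg => exact add_mem hf hg

theorem genFrac_span : Submodule.span k (Set.range (genFrac b P)) = ⊤ := by
  rw [eq_top_iff]
  rintro x -
  obtain ⟨t, ω, rfl⟩ := LC.exists_frac b P x
  rw [← formCoeff_smul_volForm b P ω]
  have hf : formCoeff b ω ∈ Submodule.span k (Set.range (monomialAt b P)) := by
    rw [monomialAt_span]; trivial
  generalize formCoeff b ω = f at hf
  induction hf using Submodule.span_induction with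
  | mem f hf =>
    obtain ⟨m, rfl⟩ := hf
    by_cases hm : m ≤ diagExp n t
    · refine Submodule.subset_span ⟨diagExp n t - m, ?_⟩
      rw [← genFrac_eq b P _ t tsub_le_self, tsub_tsub_cancel_of_le hm]
    · rw [frac_monomialAt_eq_zero b P m t hm]; exact zero_mem _
  | zero => simp
  | add f g _ _ hf hg => rw [add_smul, map_add]; exact add_mem hf hg
  | smul c f _ hf =>
    rw [smul_assoc, ← algebraMap_smul (PolyRing k V) c, map_smul, algebraMap_smul]
    exact Submodule.smul_mem _ _ hf

theorem genFrac_linearIndependent : LinearIndependent k (genFrac b P) :=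
  LinearIndependent.of_pairwise_dual_eq_zero_one _
    (fun a => res b P ∘ₗ Algebra.lsmul k k (LC b P) (monomialAt b P a))
    (fun a c h => by
      simp [res_smul_genFrac, taylor_monomialAt, MvPolynomial.coeff_monomial, h])
    (fun a => by simp [res_smul_genFrac, taylor_monomialAt])

/-- The generalised fractions `[dz / z^(a+1)]` form a basis of `LC(V, P)`. -/
def LC.basis : Module.Basis (Fin n →₀ ℕ) k (LC b P) :=
  Module.Basis.mk (genFrac_linearIndependent b P) (genFrac_span b P).ge

theorem LC.basis_apply (a : Fin n →₀ ℕ) : LC.basis b P a = genFrac b P a := by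
  simp [LC.basis]

/-- The coproduct of `LC(V, P)`. For `ξ_a = [dz / z^(a+1)]` it is `Δ ξ_a = ∑_{c + d = a} ξ_c ⊗ ξ_d`;
in characteristic zero, in terms of `|e_{i_1}, …, e_{i_s}⟩ = a! ξ_a`, where `e_i` occurs `a_i` times
among the `e_{i_t}`, this says that
`Δ |ν_1, …, ν_s⟩ = ∑_{I ⊆ {1, …, s}} |ν_I⟩ ⊗ |ν_{I^c}⟩`. It is the transpose of the multiplication
of `R` under the residue pairing, see `LC.comul_pairing`. -/
def LC.comul : LC b P →ₗ[k] LC b P ⊗[k] LC b P :=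
  (LC.basis b P).constr k fun a =>
    ∑ p ∈ Finset.HasAntidiagonal.antidiagonal a, genFrac b P p.1 ⊗ₜ[k] genFrac b P p.2

theorem LC.comul_genFrac (a : Fin n →₀ ℕ) : LC.comul b P (genFrac b P a) =
    ∑ p ∈ Finset.HasAntidiagonal.antidiagonal a, genFrac b P p.1 ⊗ₜ[k] genFrac b P p.2 := by
  rw [← LC.basis_apply, LC.comul, Module.Basis.constr_basis]

/-- `Res_P [dz / z^(a+1)]` is `1` if `a = 0` and `0` otherwise. -/
theorem res_genFrac (a : Fin n →₀ ℕ) : res b P (genFrac b P a) = if a = 0 then 1 else 0 := by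
  have := res_smul_genFrac b P 1 a
  rw [one_smul, map_one] at this
  rw [this, MvPolynomial.coeff_one]
  simp [eq_comm]

instance : CoalgebraStruct k (LC b P) where
  comul := LC.comul b P
  counit := res b P

instance : Coalgebra k (LC b P) where
  coassoc := (LC.basis b P).ext fun a => by
    simp only [LC.basis_apply, LinearMap.comp_apply, LinearEquiv.coe_coe]
    change TensorProduct.assoc k _ _ _ ((LC.comul b P).rTensor _ (LC.comul b P _)) =
      (LC.comul b P).lTensor _ (LC.comul b P _)
    simp only [LC.comul_genFrac, map_sum, LinearMap.rTensor_tmul, LinearMap.lTensor_tmul,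
      TensorProduct.sum_tmul, TensorProduct.tmul_sum, TensorProduct.assoc_tmul]
    rw [Finset.sum_sigma', Finset.sum_sigma']
    refine Finset.sum_nbij' (fun x => ⟨(x.2.1, x.2.2 + x.1.2), (x.2.2, x.1.2)⟩)
      (fun x => ⟨(x.1.1 + x.2.1, x.2.2), (x.1.1, x.2.1)⟩) ?_ ?_ ?_ ?_ ?_ <;>
    · rintro ⟨⟨c, d⟩, ⟨e, f⟩⟩ h
      simp only [Finset.mem_sigma, Finset.HasAntidiagonal.mem_antidiagonal] at h
      obtain ⟨h1, h2⟩ := h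
      simp only [← h1, ← h2, Finset.mem_sigma, Finset.HasAntidiagonal.mem_antidiagonal, add_assoc,
        and_self]
  rTensor_counit_comp_comul := (LC.basis b P).ext fun a => by
    simp only [LC.basis_apply, LinearMap.comp_apply]
    change (res b P).rTensor _ (LC.comul b P _) = _
    simp only [LC.comul_genFrac, map_sum, LinearMap.rTensor_tmul, res_genFrac]
    rw [Finset.sum_eq_single (0, a)]
    · simp
    · rintro ⟨c, d⟩ h1 h2
      have hc : c ≠ 0 := by
        rintro rfl
        simp_all
      simp [hc]
    · simp
  lTensor_counit_comp_comul := (LC.basis b P).ext fun a => by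
    simp only [LC.basis_apply, LinearMap.comp_apply]
    change (res b P).lTensor _ (LC.comul b P _) = _
    simp only [LC.comul_genFrac, map_sum, LinearMap.lTensor_tmul, res_genFrac]
    rw [Finset.sum_eq_single (a, 0)]
    · simp
    · rintro ⟨c, d⟩ h1 h2
      have hd : d ≠ 0 := by
        rintro rfl
        simp_all
      simp [hd]
    · simp

/-- The coproduct is the transpose of the multiplication of `R` under the residue pairing. -/
theorem LC.comul_pairing (f g : PolyRing k V) (η : LC b P) :
    LinearMap.mul' k k (TensorProduct.map (res b P ∘ₗ Algebra.lsmul k k (LC b P) f)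
      (res b P ∘ₗ Algebra.lsmul k k (LC b P) g) (LC.comul b P η)) = res b P ((f * g) • η) := by
  have : LinearMap.mul' k k ∘ₗ TensorProduct.map (res b P ∘ₗ Algebra.lsmul k k (LC b P) f)
      (res b P ∘ₗ Algebra.lsmul k k (LC b P) g) ∘ₗ LC.comul b P =
      res b P ∘ₗ Algebra.lsmul k k (LC b P) (f * g) := by
    refine (LC.basis b P).ext fun a => ?_
    simp only [LC.basis_apply, LinearMap.comp_apply, LC.comul_genFrac, map_sum,
      TensorProduct.map_tmul, LinearMap.mul'_apply, Algebra.lsmul_coe, res_smul_genFrac]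
    rw [map_mul, MvPolynomial.coeff_mul]
  exact congrArg (fun L => L η) this

instance : Coalgebra.IsCocomm k (LC b P) where
  comm_comp_comul := (LC.basis b P).ext fun a => by
    simp only [LC.basis_apply, LinearMap.comp_apply, LinearEquiv.coe_coe]
    change TensorProduct.comm k _ _ (LC.comul b P _) = LC.comul b P _
    simp only [LC.comul_genFrac, map_sum, TensorProduct.comm_tmul]
    exact Finset.sum_nbij' Prod.swap Prod.swap (by simp [add_comm]) (by simp [add_comm])
      (by simp) (by simp) (by simp)

end Poly

section Contraction

variable {k : Type*} [Field k] {V : Type*} [AddCommGroup V] [Module k V]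

section Comul
variable {C : Type*} [AddCommGroup C] [Module k C]

variable (k C) in
/-- The concatenation `C^{⊗ l} ⊗ C → C^{⊗ (l+1)}`. -/
def appendLast (l : ℕ) : (⨂[k]^l C) ⊗[k] C →ₗ[k] ⨂[k]^(l + 1) C :=
  TensorPower.mulEquiv.toLinearMap ∘ₗ
    (PiTensorProduct.subsingletonEquiv (R := k) (s := fun _ : Fin 1 => C) (0 : Fin 1)).symm.toLinearMap.lTensor _

theorem appendLast_tprod (l : ℕ) (c : Fin l → C) (d : C) :
    appendLast k C l (PiTensorProduct.tprod k c ⊗ₜ d) =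
      PiTensorProduct.tprod k (Fin.snoc c d : Fin (l + 1) → C) := by
  rw [appendLast, LinearMap.comp_apply, LinearMap.lTensor_tmul, LinearEquiv.coe_coe,
    LinearEquiv.coe_coe, PiTensorProduct.subsingletonEquiv_symm_apply]
  refine (TensorPower.tprod_mul_tprod k c _).trans ?_
  rw [Fin.append_right_eq_snoc]
  simp

variable (k) in
/-- Invariance of a tensor under the symmetric group. -/
def IsSymmTensor {l : ℕ} (t : ⨂[k]^l C) : Prop :=
  ∀ σ : Equiv.Perm (Fin l), PiTensorProduct.reindex k (fun _ => C) σ t = t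

theorem reindex_swap_castSucc (l : ℕ) (i j : Fin l) (x : (⨂[k]^l C) ⊗[k] C) :
    PiTensorProduct.reindex k (fun _ => C) (Equiv.swap i.castSucc j.castSucc)
      (appendLast k C l x) = appendLast k C l
        ((PiTensorProduct.reindex k (fun _ => C) (Equiv.swap i j)).toLinearMap.rTensor C x) := by
  induction x using TensorProduct.induction_on with
  | zero => simp
  | add x y hx hy => simp only [map_add, hx, hy]
  | tmul x d =>
    induction x using PiTensorProduct.induction_on with
    | add x y hx hy => simp only [map_add, hx, hy, TensorProduct.add_tmul]
    | smul_tprod r c =>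
      simp only [← TensorProduct.smul_tmul', map_smul, appendLast_tprod, LinearMap.rTensor_tmul,
        LinearEquiv.coe_coe, PiTensorProduct.reindex_tprod]
      congr 2
      funext a
      refine Fin.lastCases ?_ (fun a => ?_) a
      · rw [Equiv.symm_swap, Equiv.swap_apply_of_ne_of_ne (Fin.castSucc_lt_last i).ne'
          (Fin.castSucc_lt_last j).ne', Fin.snoc_last, Fin.snoc_last]
      · rw [Equiv.symm_swap, Equiv.symm_swap, ← (Fin.castSucc_injective l).map_swap,
          Fin.snoc_castSucc, Fin.snoc_castSucc]

theorem reindex_swap_last (l : ℕ) (x : ((⨂[k]^l C) ⊗[k] C) ⊗[k] C) :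
    PiTensorProduct.reindex k (fun _ => C) (Equiv.swap (Fin.last l).castSucc (Fin.last l).succ)
      (appendLast k C (l + 1) ((appendLast k C l).rTensor C x)) =
    appendLast k C (l + 1) ((appendLast k C l).rTensor C
      (TensorProduct.rightComm k (⨂[k]^l C) C C x)) := by
  induction x using TensorProduct.induction_on with
  | zero => simp
  | add x y hx hy => simp only [map_add, hx, hy]
  | tmul x e =>
    induction x using TensorProduct.induction_on with
    | zero => simp
    | add x y hx hy => simp only [map_add, hx, hy, TensorProduct.add_tmul]
    | tmul x d =>
      induction x using PiTensorProduct.induction_on with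
      | add x y hx hy => simp only [map_add, hx, hy, TensorProduct.add_tmul]
      | smul_tprod r c =>
        simp only [← TensorProduct.smul_tmul', map_smul, TensorProduct.rightComm_tmul,
          appendLast_tprod, LinearMap.rTensor_tmul, PiTensorProduct.reindex_tprod]
        congr 2
        funext a
        rw [Equiv.symm_swap, Fin.succ_last]
        refine Fin.lastCases ?_ (fun a => ?_) a
        · rw [Equiv.swap_apply_right, Fin.snoc_castSucc, Fin.snoc_last, Fin.snoc_last]
        · refine Fin.lastCases ?_ (fun a => ?_) a
          · rw [Equiv.swap_apply_left, Fin.snoc_castSucc, Fin.snoc_last, Fin.snoc_last]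
          · rw [Equiv.swap_apply_of_ne_of_ne, Fin.snoc_castSucc, Fin.snoc_castSucc,
              Fin.snoc_castSucc, Fin.snoc_castSucc]
            · exact fun h => (Fin.castSucc_lt_last a).ne (Fin.castSucc_injective _ h)
            · exact (Fin.castSucc_lt_last _).ne

variable [Coalgebra k C]

variable (k C) in
/-- The iterated coproduct: `iterComul k C l = Δ^(l-1) : C → C^{⊗ l}`, where `Δ^(-1)` is the counit
and `Δ^l = (Δ^(l-1) ⊗ id) Δ`. -/
def iterComul : (l : ℕ) → C →ₗ[k] ⨂[k]^l C
  | 0 => (TensorPower.algebraMap₀ (R := k) (M := C)).toLinearMap ∘ₗ Coalgebra.counit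
  | l + 1 => appendLast k C l ∘ₗ (iterComul l).rTensor C ∘ₗ Coalgebra.comul

/-- `Δ^0` is the identity. -/
theorem iterComul_one (c : C) : iterComul k C 1 c = PiTensorProduct.tprod k fun _ => c := by
  have h : iterComul k C 1 = appendLast k C 0 ∘ₗ
      (TensorPower.algebraMap₀ (R := k) (M := C)).toLinearMap.rTensor C ∘ₗ
        (Coalgebra.counit (R := k) (A := C)).rTensor C ∘ₗ Coalgebra.comul := by
    rw [iterComul, iterComul, LinearMap.rTensor_comp, LinearMap.comp_assoc]
  rw [h, Coalgebra.rTensor_counit_comp_comul]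
  simp only [LinearMap.comp_apply, TensorProduct.mk_apply, LinearMap.rTensor_tmul,
    LinearEquiv.coe_coe, TensorPower.algebraMap₀_one, TensorPower.gOne_def]
  refine (appendLast_tprod 0 _ c).trans ?_
  exact congrArg _ (funext fun i => by
    obtain rfl : i = Fin.last 0 := by omega
    rw [Fin.snoc_last])

theorem rightComm_comul [Coalgebra.IsCocomm k C] (c : C) :
    TensorProduct.rightComm k C C C ((Coalgebra.comul (R := k)).rTensor C
      (Coalgebra.comul (R := k) c)) =
    (Coalgebra.comul (R := k)).rTensor C (Coalgebra.comul (R := k) c) := by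
  have h1 : ∀ x : (C ⊗[k] C) ⊗[k] C, TensorProduct.rightComm k C C C x =
      (TensorProduct.assoc k C C C).symm ((TensorProduct.comm k C C).toLinearMap.lTensor C
        (TensorProduct.assoc k C C C x)) := by
    intro x
    induction x using TensorProduct.induction_on with
    | zero => simp
    | add x y hx hy => simp only [map_add, hx, hy]
    | tmul x e =>
      induction x using TensorProduct.induction_on with
      | zero => simp
      | add x y hx hy => simp only [map_add, hx, hy, TensorProduct.add_tmul]
      | tmul x d => simp
  rw [h1, Coalgebra.coassoc_apply, ← LinearMap.comp_apply (LinearMap.lTensor C _),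
    ← LinearMap.lTensor_comp, Coalgebra.IsCocomm.comm_comp_comul, ← Coalgebra.coassoc_apply,
    LinearEquiv.symm_apply_apply]

theorem isSymmTensor_iterComul [Coalgebra.IsCocomm k C] (c : C) (l : ℕ) :
    IsSymmTensor k (iterComul k C l c) := by
  induction l generalizing c with
  | zero => intro σ; rw [Subsingleton.elim σ (Equiv.refl _), PiTensorProduct.reindex_refl]; rfl
  | succ l ih =>
    intro σ
    have hσ : σ ∈ Submonoid.closure
        (Set.range fun i : Fin l => Equiv.swap i.castSucc i.succ) := by
      rw [Equiv.Perm.mclosure_swap_castSucc_succ]; trivial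
    induction hσ using Submonoid.closure_induction with
    | one =>
      change PiTensorProduct.reindex k (fun _ => C) (Equiv.refl _) _ = _
      rw [PiTensorProduct.reindex_refl]; rfl
    | mul σ τ _ _ hσ hτ =>
      have : σ * τ = τ.trans σ := rfl
      rw [this]
      refine (PiTensorProduct.reindex_reindex (R := k) (s := fun _ => C) τ σ _).symm.trans ?_
      rw [hτ]
      exact hσ
    | mem σ h =>
      obtain ⟨i, rfl⟩ := h
      cases l with
      | zero => exact i.elim0
      | succ m =>
        refine Fin.lastCases ?_ (fun j => ?_) i
        · have h : iterComul k C (m + 2) c = appendLast k C (m + 1) ((appendLast k C m).rTensor C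
              (((iterComul k C m).rTensor C).rTensor C ((Coalgebra.comul (R := k)).rTensor C
                (Coalgebra.comul (R := k) c)))) := by
            simp only [iterComul, LinearMap.rTensor_comp, LinearMap.comp_apply]
          have h2 : ∀ x : (C ⊗[k] C) ⊗[k] C, TensorProduct.rightComm k (⨂[k]^m C) C C
              (((iterComul k C m).rTensor C).rTensor C x) =
              ((iterComul k C m).rTensor C).rTensor C (TensorProduct.rightComm k C C C x) := by
            intro x
            induction x using TensorProduct.induction_on with
            | zero => simp
            | add x y hx hy => simp only [map_add, hx, hy]
            | tmul x e =>
              induction x using TensorProduct.induction_on with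
              | zero => simp
              | add x y hx hy => simp only [map_add, hx, hy, TensorProduct.add_tmul]
              | tmul x d => simp
          rw [h]
          refine (reindex_swap_last m _).trans ?_
          rw [h2, rightComm_comul]
        · have h : ∀ x, iterComul k C (m + 2) x = appendLast k C (m + 1)
              ((iterComul k C (m + 1)).rTensor C (Coalgebra.comul (R := k) x)) := fun _ => rfl
          change PiTensorProduct.reindex k (fun _ => C)
            (Equiv.swap j.castSucc.castSucc j.succ.castSucc) _ = _
          rw [h]
          refine (reindex_swap_castSucc (m + 1) j.castSucc j.succ _).trans ?_
          rw [← LinearMap.comp_apply (LinearMap.rTensor C _), ← LinearMap.rTensor_comp]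
          congr 3
          exact LinearMap.ext fun x => ih x _

end Comul

variable (k V) in
/-- The space `∏_l (V^{⊗ l})^{S_l}` of sequences of symmetric tensors. -/
def symmSeq : Submodule k (∀ l : ℕ, ⨂[k]^l V) where
  carrier := {t | ∀ l, IsSymmTensor k (t l)}
  zero_mem' _ _ := map_zero _
  add_mem' hs ht l σ := (map_add _ _ _).trans (congrArg₂ _ (hs l σ) (ht l σ))
  smul_mem' _ _ ht l σ := (map_smul _ _ _).trans (congrArg _ (ht l σ))

/-- Contraction of the tensor algebra of `V^*` against a sequence of tensors:
`κ_1 ⊗ ⋯ ⊗ κ_q` is paired with the component in `V^{⊗ q}` by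
`⟨κ_1 ⊗ ⋯ ⊗ κ_q, v_1 ⊗ ⋯ ⊗ v_q⟩ = κ_1(v_1) ⋯ κ_q(v_q)`. -/
def contractTensor (t : ∀ l : ℕ, ⨂[k]^l V) : TensorAlgebra k (Module.Dual k V) →ₗ[k] k :=
  DirectSum.toModule k ℕ k (fun l => (TensorPower.pairingDual k V l).flip (t l)) ∘ₗ
    (TensorAlgebra.toDirectSum (R := k) (M := Module.Dual k V)).toLinearMap

theorem contractTensor_tprod (t : ∀ l : ℕ, ⨂[k]^l V) {l : ℕ} (κ : Fin l → Module.Dual k V) :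
    contractTensor t (List.ofFn fun i => TensorAlgebra.ι k (κ i)).prod =
      TensorPower.pairingDual k V l (PiTensorProduct.tprod k κ) (t l) := by
  rw [← TensorAlgebra.tprod_apply, contractTensor, LinearMap.comp_apply, AlgHom.toLinearMap_apply,
    TensorAlgebra.toDirectSum_tensorPower_tprod, ← DirectSum.lof_eq_of k, DirectSum.toModule_lof,
    LinearMap.flip_apply]

theorem pairingDual_perm {l : ℕ} {t : ⨂[k]^l V} (ht : IsSymmTensor k t)
    (κ : Fin l → Module.Dual k V) (σ : Equiv.Perm (Fin l)) :
    TensorPower.pairingDual k V l (PiTensorProduct.tprod k (κ ∘ σ)) t =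
      TensorPower.pairingDual k V l (PiTensorProduct.tprod k κ) t := by
  have h : TensorPower.pairingDual k V l (PiTensorProduct.tprod k (κ ∘ σ)) =
      TensorPower.pairingDual k V l (PiTensorProduct.tprod k κ) ∘ₗ
        (PiTensorProduct.reindex k (fun _ => V) σ).toLinearMap := by
    refine PiTensorProduct.ext (MultilinearMap.ext fun v => ?_)
    simp only [LinearMap.compMultilinearMap_apply, LinearMap.comp_apply, LinearEquiv.coe_coe,
      PiTensorProduct.reindex_tprod, TensorPower.pairingDual_tprod_tprod]
    exact Fintype.prod_equiv σ _ _ fun i => by simp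
  rw [h, LinearMap.comp_apply, LinearEquiv.coe_coe, ht σ]

theorem contractTensor_swap {t : ∀ l : ℕ, ⨂[k]^l V} (ht : t ∈ symmSeq k V)
    (A B : List (Module.Dual k V)) (κ κ' : Module.Dual k V) :
    contractTensor t ((A ++ κ :: κ' :: B).map (TensorAlgebra.ι k)).prod =
      contractTensor t ((A ++ κ' :: κ :: B).map (TensorAlgebra.ι k)).prod := by
  set n := (A ++ κ :: κ' :: B).length with hn
  have hn' : n = A.length + (B.length + 2) := by simp [hn]
  let f : Fin n → Module.Dual k V := fun i => (A ++ κ :: κ' :: B)[i]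
  let σ : Equiv.Perm (Fin n) := Equiv.swap ⟨A.length, by omega⟩ ⟨A.length + 1, by omega⟩
  have h1 : A ++ κ :: κ' :: B = List.ofFn f := List.ofFn_getElem.symm
  have h2 : A ++ κ' :: κ :: B = List.ofFn (f ∘ σ) := by
    refine List.ext_getElem (by simp [hn']; omega) fun i hi hi' => ?_
    simp only [List.getElem_ofFn, Function.comp_apply, f, σ, Equiv.swap_apply_def, Fin.mk.injEq]
    split_ifs with h h' <;> grind
  rw [h1, h2, List.map_ofFn, List.map_ofFn]
  exact ((contractTensor_tprod t f).trans (pairingDual_perm (ht n) f σ).symm).trans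
    (contractTensor_tprod t (f ∘ σ)).symm

theorem tensorAlgebra_span (k W : Type*) [Field k] [AddCommGroup W] [Module k W] :
    Submodule.span k (Set.range fun A : List W => (A.map (TensorAlgebra.ι k)).prod) = ⊤ := by
  rw [eq_top_iff, ← Algebra.top_toSubmodule, ← TensorAlgebra.adjoin_range_ι,
    Algebra.adjoin_eq_span]
  refine Submodule.span_mono fun x hx => ?_
  obtain ⟨L, hL, rfl⟩ := Submonoid.exists_list_of_mem_closure hx
  obtain ⟨A, rfl⟩ : L ∈ Set.range (List.map (TensorAlgebra.ι k : W → TensorAlgebra k W)) := by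
    rw [Set.range_list_map]; exact hL
  exact ⟨A, rfl⟩

/-- Auxiliary: the congruence of elements of the tensor algebra that contract equally in all contexts. -/
def contractCon (t : ∀ l : ℕ, ⨂[k]^l V) : RingCon (TensorAlgebra k (Module.Dual k V)) where
  r x y := ∀ u v, contractTensor t (u * x * v) = contractTensor t (u * y * v)
  iseqv := ⟨fun _ _ _ => rfl, fun h u v => (h u v).symm, fun h h' u v => (h u v).trans (h' u v)⟩
  add' h h' u v := by simp only [mul_add, add_mul, map_add, h u v, h' u v]
  mul' {w x y z} h h' u v := by
    have h1 := h u (y * v)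
    have h2 := h' (u * x) v
    simp only [mul_assoc] at h1 h2 ⊢
    rw [h1, h2]

theorem symRingCon_le {t : ∀ l : ℕ, ⨂[k]^l V} (ht : t ∈ symmSeq k V) :
    TensorAlgebra.symRingCon k (Module.Dual k V) ≤ contractCon t := by
  refine RingCon.ringConGen_le.2 fun x y h => ?_
  obtain ⟨κ, κ'⟩ := h
  intro u v
  have hu : u ∈ Submodule.span k (Set.range fun A : List (Module.Dual k V) =>
    (A.map (TensorAlgebra.ι k)).prod) := by rw [tensorAlgebra_span]; trivial
  have hv : v ∈ Submodule.span k (Set.range fun A : List (Module.Dual k V) =>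
    (A.map (TensorAlgebra.ι k)).prod) := by rw [tensorAlgebra_span]; trivial
  induction hu using Submodule.span_induction with
  | zero => simp
  | add x y _ _ hx hy => simp only [add_mul, map_add, hx, hy]
  | smul c x _ hx => simp only [smul_mul_assoc, map_smul, hx]
  | mem u hu =>
    obtain ⟨A, rfl⟩ := hu
    induction hv using Submodule.span_induction with
    | zero => simp
    | add x y _ _ hx hy => simp only [mul_add, map_add, hx, hy]
    | smul c x _ hx => simp only [mul_smul_comm, map_smul, hx]
    | mem v hv =>
      obtain ⟨B, rfl⟩ := hv
      simpa [mul_assoc] using contractTensor_swap ht A B κ κ'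

/-- The contraction `f ⌟ t` of `f ∈ Sym(V^*)` against a sequence `t` of symmetric tensors, induced by
`contractTensor` on the quotient `Sym(V^*)` of the tensor algebra of `V^*`. -/
def contract (t : symmSeq k V) : PolyRing k V →ₗ[k] k :=
  (LinearMap.ker (SymmetricAlgebra.algHom k (Module.Dual k V)).toLinearMap).liftQ
      (contractTensor t.1) (fun x hx => by
        have h : TensorAlgebra.symRingCon k (Module.Dual k V) x 0 := (RingCon.eq _).1 hx
        simpa using symRingCon_le t.2 h 1 1) ∘ₗ
    ((SymmetricAlgebra.algHom k (Module.Dual k V)).toLinearMap.quotKerEquivOfSurjective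
      (SymmetricAlgebra.algHom_surjective k (Module.Dual k V))).symm.toLinearMap

theorem contract_algHom (t : symmSeq k V) (x : TensorAlgebra k (Module.Dual k V)) :
    contract t (SymmetricAlgebra.algHom k (Module.Dual k V) x) = contractTensor t.1 x := by
  have h : ((SymmetricAlgebra.algHom k (Module.Dual k V)).toLinearMap.quotKerEquivOfSurjective
      (SymmetricAlgebra.algHom_surjective k (Module.Dual k V))).symm
      (SymmetricAlgebra.algHom k (Module.Dual k V) x) = Submodule.Quotient.mk x := by
    rw [LinearEquiv.symm_apply_eq]; rfl
  rw [contract, LinearMap.comp_apply, LinearEquiv.coe_coe, h]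
  exact Submodule.liftQ_apply _ _ _

/-- `(κ_1 ⋯ κ_q) ⌟ t = ⟨κ_1 ⊗ ⋯ ⊗ κ_q, t_q⟩`. -/
theorem contract_prod (t : symmSeq k V) {l : ℕ} (κ : Fin l → Module.Dual k V) :
    contract t (∏ i, SymmetricAlgebra.ι k _ (κ i)) =
      TensorPower.pairingDual k V l (PiTensorProduct.tprod k κ) (t.1 l) := by
  rw [← contractTensor_tprod, ← contract_algHom, map_list_prod, List.map_ofFn, ← List.prod_ofFn]
  rfl

variable {C : Type*} [AddCommGroup C] [Module k C] [Coalgebra k C] [Coalgebra.IsCocomm k C]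

/-- The sequence `(ε(η), φ(η), φ^{⊗ 2} Δ(η), …)` of symmetric tensors. -/
def powerSeq (φ : C →ₗ[k] V) (η : C) : symmSeq k V :=
  ⟨fun l => PiTensorProduct.map (fun _ => φ) (iterComul k C l η), fun l σ => by
    rw [← PiTensorProduct.map_reindex (R := k) (fun _ => φ) σ, isSymmTensor_iterComul]⟩

end Contraction

section Bang

variable {k : Type*} [Field k] {V : Type*} [AddCommGroup V] [Module k V]
  {n : ℕ} (b : Module.Basis (Fin n) k V)

/-- The coalgebra `!V`, the direct sum over all points `P` of `V` of the local cohomology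
modules `LC b P`. -/
def Bang : Type _ := ⨁ P : V, LC b P

instance instAddCommGroupBang : AddCommGroup (Bang b) :=
  inferInstanceAs (AddCommGroup (⨁ P : V, LC b P))

instance instModuleBang : Module k (Bang b) := inferInstanceAs (Module k (⨁ P : V, LC b P))

instance instPolyModuleBang : Module (PolyRing k V) (Bang b) :=
  inferInstanceAs (Module (PolyRing k V) (⨁ P : V, LC b P))

instance instIsScalarTowerBang : IsScalarTower k (PolyRing k V) (Bang b) :=
  inferInstanceAs (IsScalarTower k (PolyRing k V) (Π₀ P : V, LC b P))

open Classical in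
/-- The direct sum coalgebra structure on `!V`. -/
instance instCoalgebraBang : Coalgebra k (Bang b) :=
  inferInstanceAs (Coalgebra k (Π₀ P : V, LC b P))

open Classical in
instance instIsCocommBang : Coalgebra.IsCocomm k (Bang b) :=
  inferInstanceAs (Coalgebra.IsCocomm k (Π₀ P : V, LC b P))

open Classical in
/-- The inclusion of the summand `LC(V, P)` in `!V`. -/
def Bang.incl (P : V) : LC b P →ₗ[k] Bang b := DirectSum.lof k V (LC b) P

/-- The coproduct of `!V` restricts to the coproduct of each summand. -/
theorem Bang.comul_incl (P : V) (η : LC b P) :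
    Coalgebra.comul (R := k) (Bang.incl b P η) =
      TensorProduct.map (Bang.incl b P) (Bang.incl b P) (LC.comul b P η) := by
  classical
  exact DFinsupp.comul_single k V (LC b) P η

theorem Bang.smul_incl (P : V) (f : PolyRing k V) (η : LC b P) :
    f • Bang.incl b P η = Bang.incl b P (f • η) := by
  classical
  exact (map_smul (DirectSum.lof (PolyRing k V) V (LC b) P) f η).symm

theorem Bang.hom_ext {W : Type*} [AddCommGroup W] [Module k W] {F G : Bang b →ₗ[k] W}
    (h : ∀ P, F ∘ₗ Bang.incl b P = G ∘ₗ Bang.incl b P) : F = G := by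
  classical
  exact DirectSum.linearMap_ext k h

open Classical in
/-- The total residue `Res = ∑_P Res_P : !V → k`. -/
def totalRes : Bang b →ₗ[k] k := DirectSum.toModule k V k fun P => res b P

/-- The total residue is the counit of `!V`. -/
theorem counit_eq_totalRes : (Coalgebra.counit : Bang b →ₗ[k] k) = totalRes b := rfl

theorem totalRes_incl (P : V) (η : LC b P) : totalRes b (Bang.incl b P η) = res b P η := by
  classical
  exact DirectSum.toModule_lof k P η

/-- `d_P η = ∑_i Res_P(x_i η) e_i`. -/
def derelictionAt (P : V) : LC b P →ₗ[k] V :=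
  ∑ i, (res b P ∘ₗ Algebra.lsmul k k (LC b P) (coordFn b i)).smulRight (b i)

open Classical in
/-- The dereliction map `d = ∑_P d_P : !V → V`. -/
def dereliction : Bang b →ₗ[k] V := DirectSum.toModule k V V fun P => derelictionAt b P

theorem dereliction_incl (P : V) (η : LC b P) :
    dereliction b (Bang.incl b P η) = derelictionAt b P η := by
  classical
  exact DirectSum.toModule_lof k P η

end Bang

end CofreeCoalg

end

/-! The residue pairing `f, ω ↦ Res(f ω)` embeds `!V` in the dual space of `R`, and every functional
on `R` that kills an ideal of finite codimension lies in the image (`resPairing_injective`,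
`exists_resPairing_eq`). To see this, let `R` act on its dual by transposed multiplication. If `I`
has finite codimension, then over an algebraically closed field the dual of `R/I` is the sum of the
joint generalised eigenspaces of the commuting operators `x_i`. A joint eigenvalue is the coordinate
vector of a point `P`, and the corresponding eigenspace in the dual of `R` is the image of `LC(V,
P)`, where the `ξ_a` are dual to the monomials `z^a`. Eigenspaces of distinct points are
independent, which gives injectivity.

The coproduct of `!V` is the transpose of multiplication, so the pairing is an algebra homomorphism
from `R` to the convolution algebra of `!V` (`resAlgHom`). Since `C` is cocommutative, its
convolution algebra is commutative and `κ ↦ κ ∘ φ` extends to an algebra homomorphism `convHom φ` on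
`R`; its value at `η` is exactly the contraction with the sequence `φ^{⊗(l+1)} Δ^l(η)`
(`convHom_apply`).

If `Φ` is a coalgebra morphism with `d ∘ Φ = φ`, then `f ↦ Res(f Φ(-))` is an algebra homomorphism
that agrees with `convHom φ` on linear forms, hence everywhere. This is the formula, and injectivity
of the pairing gives uniqueness. For existence, `f ↦ convHom φ f η` kills an ideal of finite
codimension because `Δ η` is a finite sum of pure tensors, so it is represented by an element of
`!V`. The resulting map is a coalgebra morphism because `convHom φ` is multiplicative and the
functionals `Res(f -)` separate points. -/

noncomputable section

namespace CofreeCoalg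

/-! ### Transposed multiplication and joint generalised eigenspaces. -/

section MulDual

variable (k : Type*) [Field k] (A : Type*) [CommRing A] [Algebra k A]

/-- The action of a commutative algebra on its dual space by transposed multiplication. -/
def mulDual : A →ₐ[k] Module.End k (Module.Dual k A) :=
  AlgHom.ofLinearMap (Module.Dual.transpose (R := k) ∘ₗ LinearMap.mul k A)
    (by ext; simp [Module.Dual.transpose_apply])
    (fun f g => by ext; simp [Module.Dual.transpose_apply, mul_left_comm, mul_comm])

variable {k A}

theorem mulDual_apply (f : A) (l : Module.Dual k A) (g : A) : mulDual k A f l g = l (f * g) := rfl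

/-- A functional vanishing on an ideal of finite codimension is a sum of joint generalised
eigenvectors for the transposed multiplications. -/
theorem mem_iSup_of_vanishes [IsAlgClosed k] {ι : Type*} (x : ι → A) (I : Ideal A)
    [FiniteDimensional k (A ⧸ I)] (l : Module.Dual k A) (hl : ∀ f ∈ I, l f = 0) :
    l ∈ ⨆ χ : ι → k, ⨅ i, (mulDual k A (x i)).maxGenEigenspace (χ i) := by
  -- The dual of `A ⧸ I` sits in the dual of `A` compatibly with both actions, so the decomposition
  -- can be made in finite dimension and transported along `j`.
  let j : Module.Dual k (A ⧸ I) →ₗ[k] Module.Dual k A :=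
    (Ideal.Quotient.mkₐ k I).toLinearMap.dualMap
  have hj : ∀ f m, j (mulDual k (A ⧸ I) (Ideal.Quotient.mk I f) m) = mulDual k A f (j m) :=
    fun f m => LinearMap.ext fun g => by simp [j, mulDual_apply]
  obtain ⟨m, rfl⟩ : ∃ m, j m = l := by
    refine ⟨(I.restrictScalars k).liftQ l hl, LinearMap.ext fun g => ?_⟩
    exact (I.restrictScalars k).liftQ_apply l (h := hl) g
  have htop : ⨆ χ : ι → k, ⨅ i, (mulDual k (A ⧸ I)
      (Ideal.Quotient.mk I (x i))).maxGenEigenspace (χ i) = ⊤ := by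
    refine Module.End.iSup_iInf_maxGenEigenspace_eq_top_of_iSup_maxGenEigenspace_eq_top_of_commute
      _ (fun i i' _ => ?_) fun i => Module.End.iSup_maxGenEigenspace_eq_top _
    exact (Commute.all _ _).map (mulDual k (A ⧸ I))
  have hm : m ∈ ⨆ χ : ι → k, ⨅ i, (mulDual k (A ⧸ I)
      (Ideal.Quotient.mk I (x i))).maxGenEigenspace (χ i) := htop ▸ trivial
  induction hm using Submodule.iSup_induction' with
  | zero => simp
  | add m m' _ _ hm hm' =>
    rw [map_add]
    -- The vanishing hypothesis travels with the induction; it holds for every functional in the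
    -- image of `j`.
    exact add_mem (hm fun f hf => by simp [j, Ideal.Quotient.eq_zero_iff_mem.2 hf])
      (hm' fun f hf => by simp [j, Ideal.Quotient.eq_zero_iff_mem.2 hf])
  | mem χ m hm =>
    refine Submodule.mem_iSup_of_mem χ ?_
    simp only [Submodule.mem_iInf, Module.End.mem_maxGenEigenspace] at hm ⊢
    intro i
    obtain ⟨N, hN⟩ := hm i
    refine ⟨N, ?_⟩
    have h : ∀ (N : ℕ) (m : Module.Dual k (A ⧸ I)),
        ((mulDual k A (x i) - χ i • (1 : Module.End k (Module.Dual k A))) ^ N) (j m) =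
        j (((mulDual k (A ⧸ I) (Ideal.Quotient.mk I (x i)) -
          χ i • (1 : Module.End k (Module.Dual k (A ⧸ I)))) ^ N) m) := by
      intro N
      induction N with
      | zero => simp
      | succ N ih => intro m; simp [pow_succ, ← hj, ← ih]
    rw [h, hN, map_zero]

/-- `A ⧸ I` is a quotient of `A ⧸ ker K`, which is isomorphic to a subspace of `W`. -/
theorem finiteDimensional_quotient_of_ker_le {W : Type*} [AddCommGroup W] [Module k W]
    [FiniteDimensional k W] (I : Ideal A) (K : A →ₗ[k] W)
    (hK : ∀ f, K f = 0 → f ∈ I) : FiniteDimensional k (A ⧸ I) := by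
  have : FiniteDimensional k (A ⧸ LinearMap.ker K) :=
    Module.Finite.equiv K.quotKerEquivRange.symm
  let q : A →ₗ[k] A ⧸ I := (Ideal.Quotient.mkₐ k I).toLinearMap
  have hq : LinearMap.ker K ≤ LinearMap.ker q := fun f hf =>
    Ideal.Quotient.eq_zero_iff_mem.2 (hK f hf)
  refine Module.Finite.of_surjective ((LinearMap.ker K).liftQ q hq) fun y => ?_
  obtain ⟨f, rfl⟩ := Ideal.Quotient.mk_surjective y
  exact ⟨Submodule.Quotient.mk f, rfl⟩

theorem iSupIndep_mulDual {ι : Type*} (x : ι → A) :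
    iSupIndep fun χ : ι → k => ⨅ i, (mulDual k A (x i)).maxGenEigenspace (χ i) :=
  Module.End.independent_iInf_maxGenEigenspace_of_forall_mapsTo _ fun i j _ =>
    Module.End.mapsTo_maxGenEigenspace_of_comm ((Commute.all (x j) (x i)).map (mulDual k A)) _

end MulDual

/-- Applying `α i` to the left factor leaves an element of `B` that all `β j` kill, hence zero. Its
coordinates in a basis of `B` are the values of `α i` on the `A`-valued coefficients of `x`, so
these vanish too. This allows an identity in `!V ⊗ !V` to be tested on pairs of polynomials. -/
theorem tmul_eq_zero_of_separating {k A B ι κ : Type*} [Field k] [AddCommGroup A] [Module k A]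
    [AddCommGroup B] [Module k B] (α : ι → A →ₗ[k] k) (β : κ → B →ₗ[k] k)
    (hα : ∀ a, (∀ i, α i a = 0) → a = 0) (hβ : ∀ b, (∀ j, β j b = 0) → b = 0) (x : A ⊗[k] B)
    (hx : ∀ i j, LinearMap.mul' k k (TensorProduct.map (α i) (β j) x) = 0) : x = 0 := by
  classical
  let c := Module.Basis.ofVectorSpace k B
  apply (TensorProduct.equivFinsuppOfBasisRight (M := A) c).injective
  rw [map_zero]
  ext s
  refine hα _ fun i => ?_
  have h0 : TensorProduct.lid k B ((α i).rTensor B x) = 0 := by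
    refine hβ _ fun j => ?_
    rw [← hx i j]
    have h : β j ∘ₗ (TensorProduct.lid k B).toLinearMap ∘ₗ (α i).rTensor B =
        LinearMap.mul' k k ∘ₗ TensorProduct.map (α i) (β j) := TensorProduct.ext' fun a b => by simp
    exact congrArg (fun L => L x) h
  have h1 : ∀ y : A ⊗[k] B, α i (TensorProduct.equivFinsuppOfBasisRight (M := A) c y s) =
      c.coord s (TensorProduct.lid k B ((α i).rTensor B y)) := by
    intro y
    induction y using TensorProduct.induction_on with
    | zero => simp
    | tmul a b => simp [mul_comm]
    | add x y hx hy => simp only [map_add, Finsupp.add_apply, hx, hy]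
  rw [h1, h0, map_zero]

/-! ### The residue pairing between `!V` and `R`. -/

section Pairing

variable {k : Type*} [Field k] {V : Type*} [AddCommGroup V] [Module k V]
  {n : ℕ} (b : Module.Basis (Fin n) k V)

/-- The residue pairing `η ↦ (f ↦ Res_P(f η))`. -/
def resPairingAt (P : V) : LC b P →ₗ[k] Module.Dual k (PolyRing k V) :=
  LinearMap.mk₂ k (fun η f => res b P (f • η)) (by simp)
    (fun c η f => by rw [smul_comm f c η, map_smul])
    (by simp [add_smul]) (by simp)

theorem resPairingAt_apply (P : V) (η : LC b P) (f : PolyRing k V) :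
    resPairingAt b P η f = res b P (f • η) := rfl

/-- The residue pairing `ω ↦ (f ↦ Res(f ω))`. -/
def resPairing : Bang b →ₗ[k] Module.Dual k (PolyRing k V) :=
  LinearMap.mk₂ k (fun ω f => totalRes b (f • ω)) (by simp)
    (fun c η f => by rw [smul_comm f c η, map_smul])
    (by simp [add_smul]) (by simp)

theorem resPairing_apply (ω : Bang b) (f : PolyRing k V) :
    resPairing b ω f = totalRes b (f • ω) := rfl

theorem resPairing_incl (P : V) (η : LC b P) :
    resPairing b (Bang.incl b P η) = resPairingAt b P η :=
  LinearMap.ext fun f => by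
    rw [resPairing_apply, Bang.smul_incl, totalRes_incl, resPairingAt_apply]

/-- The functionals on `R` annihilated by powers of the local parameters at `P`. -/
def localDual (P : V) : Submodule k (Module.Dual k (PolyRing k V)) :=
  ⨅ i, (mulDual k (PolyRing k V) (coordFn b i)).maxGenEigenspace (b.coord i P)

/-- Subtracting the eigenvalue `P_i` from the action of `x_i` gives the action of `z_i`. -/
theorem mem_localDual {P : V} {l : Module.Dual k (PolyRing k V)} :
    l ∈ localDual b P ↔ ∀ i, ∃ N : ℕ, ∀ g, l (localParam b P i ^ N * g) = 0 := by
  simp only [localDual, Submodule.mem_iInf, Module.End.mem_maxGenEigenspace]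
  refine forall_congr' fun i => exists_congr fun N => ?_
  have h : mulDual k (PolyRing k V) (coordFn b i) - b.coord i P • 1 =
      mulDual k _ (localParam b P i) := by
    rw [localParam, map_sub, AlgHom.commutes, Algebra.algebraMap_eq_smul_one]
  rw [h, ← map_pow]
  exact LinearMap.ext_iff

/-- The fraction `ξ_a` is annihilated by `z_i^(a_i+1)`. -/
theorem resPairingAt_mem_localDual (P : V) (η : LC b P) : resPairingAt b P η ∈ localDual b P := by
  have hη : η ∈ Submodule.span k (Set.range (genFrac b P)) := genFrac_span b P ▸ trivial
  suffices Submodule.span k (Set.range (genFrac b P)) ≤ (localDual b P).comap (resPairingAt b P) from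
    this hη
  rw [Submodule.span_le]
  rintro _ ⟨a, rfl⟩
  refine (mem_localDual b).2 fun i => ⟨a i + 1, fun g => ?_⟩
  rw [resPairingAt_apply, res_smul_genFrac, map_mul, map_pow, taylor_localParam,
    MvPolynomial.X_pow_eq_monomial, MvPolynomial.coeff_monomial_mul', if_neg]
  intro h
  simpa using h i

/-- Pairing with the monomial `z^a` reads off the coordinate at `ξ_a`. -/
theorem resPairingAt_injective (P : V) : Function.Injective (resPairingAt b P) := by
  rw [injective_iff_map_eq_zero]
  intro η h
  refine (LC.basis b P).ext_elem fun a => ?_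
  have h1 : (LC.basis b P).coord a = (Module.Dual.eval k _ (monomialAt b P a)) ∘ₗ
      resPairingAt b P := by
    refine (LC.basis b P).ext fun c => ?_
    rw [Module.Basis.coord_apply, Module.Basis.repr_self, LinearMap.comp_apply,
      Module.Dual.eval_apply, LC.basis_apply, resPairingAt_apply, res_smul_genFrac,
      taylor_monomialAt, MvPolynomial.coeff_monomial, Finsupp.single_apply]
    simp [eq_comm]
  have := congrArg (fun L => L η) h1
  simpa [h] using this

/-- A functional killed by powers of all the `z_i` is nonzero on only finitely many monomials `z^a`,
and its values there are the coefficients of the required combination of the `ξ_a`. -/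
theorem exists_resPairingAt_eq (P : V) (l : Module.Dual k (PolyRing k V)) (hl : l ∈ localDual b P) :
    ∃ η, resPairingAt b P η = l := by
  choose N hN using (mem_localDual b).1 hl
  -- The box `a ≤ N` contains every exponent with `l (z^a) ≠ 0`; the terms with some `a_i = N_i`
  -- vanish and do no harm.
  let M : Fin n →₀ ℕ := Finsupp.equivFunOnFinite.symm N
  refine ⟨∑ a ∈ Finset.Iic M, l (monomialAt b P a) • genFrac b P a, ?_⟩
  refine LinearMap.ext_on_range (monomialAt_span b P) fun c => ?_
  rw [map_sum, LinearMap.sum_apply]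
  simp only [map_smul, LinearMap.smul_apply, resPairingAt_apply, res_smul_genFrac,
    taylor_monomialAt, MvPolynomial.coeff_monomial, smul_eq_mul, mul_ite, mul_one, mul_zero,
    Finset.sum_ite_eq, Finset.mem_Iic]
  split_ifs with hc
  · rfl
  · obtain ⟨i, hi⟩ : ∃ i, N i < c i := by
      by_contra! h
      exact hc h
    have h1 : localParam b P i ^ N i ∣ monomialAt b P c :=
      (pow_dvd_pow _ hi.le).trans
        (Finset.dvd_prod_of_mem (fun i => localParam b P i ^ c i) (Finset.mem_univ i))
    obtain ⟨g, hg⟩ := h1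
    rw [hg, hN]

/-- Distinct points have distinct coordinate vectors, hence distinct joint eigenvalues. -/
theorem iSupIndep_localDual : iSupIndep (localDual b) :=
  (iSupIndep_mulDual (coordFn b)).comp b.equivFun.injective

theorem resPairing_injective : Function.Injective (resPairing b) := by
  classical
  let F (P : V) : LC b P →ₗ[k] localDual b P :=
    (resPairingAt b P).codRestrict _ (resPairingAt_mem_localDual b P)
  have hF : ∀ P, Function.Injective (F P) := fun P x y h =>
    resPairingAt_injective b P (congrArg Subtype.val h)
  let G : Bang b →ₗ[k] Π₀ P : V, localDual b P := DFinsupp.mapRange.linearMap F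
  have hG : Function.Injective G := (DFinsupp.mapRange_injective _ fun P => map_zero (F P)).2 hF
  -- The pairing is the summandwise injection `G` followed by the summation map of an independent
  -- family, which is injective as well.
  have h : resPairing b = DFinsupp.lsum ℕ (fun P => (localDual b P).subtype) ∘ₗ G := by
    refine Bang.hom_ext b fun P => LinearMap.ext fun η => ?_
    rw [LinearMap.comp_apply, resPairing_incl]
    have : G (Bang.incl b P η) = DFinsupp.single P (F P η) :=
      DFinsupp.mapRange_single (hf := fun P => map_zero (F P))
    rw [LinearMap.comp_apply, LinearMap.comp_apply, this, DFinsupp.lsum_single]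
    rfl
  rw [h, LinearMap.coe_comp]
  exact (iSupIndep_localDual b).dfinsupp_lsum_injective.comp hG

/-- Every tuple `χ` of joint eigenvalues consists of the coordinates of a point `P`, so each summand
supplied by `mem_iSup_of_vanishes` is some `localDual b P`, all of which comes from `LC(V, P)`. -/
theorem exists_resPairing_eq [IsAlgClosed k] (I : Ideal (PolyRing k V))
    [FiniteDimensional k (PolyRing k V ⧸ I)] (l : Module.Dual k (PolyRing k V))
    (hl : ∀ f ∈ I, l f = 0) : ∃ ω, resPairing b ω = l := by
  suffices h : ⨆ χ : Fin n → k, ⨅ i, (mulDual k _ (coordFn b i)).maxGenEigenspace (χ i) ≤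
      LinearMap.range (resPairing b) from h (mem_iSup_of_vanishes (coordFn b) I l hl)
  refine iSup_le fun χ m hm => ?_
  obtain ⟨P, rfl⟩ := b.equivFun.surjective χ
  obtain ⟨η, hη⟩ := exists_resPairingAt_eq b P m hm
  exact ⟨Bang.incl b P η, (resPairing_incl b P η).trans hη⟩

/-- The residue pairing as a homomorphism from `R` to the convolution algebra of `!V`. -/
def resAlgHom : PolyRing k V →ₐ[k] WithConv (Bang b →ₗ[k] k) :=
  AlgHom.ofLinearMap ((WithConv.linearEquiv k _).symm.toLinearMap ∘ₗ (resPairing b).flip)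
    (by
      refine WithConv.ext (LinearMap.ext fun ω => ?_)
      change totalRes b ((1 : PolyRing k V) • ω) = _
      rw [one_smul, ← counit_eq_totalRes]; rfl)
    (fun f g => by
      refine WithConv.ext (Bang.hom_ext b fun P => LinearMap.ext fun η => ?_)
      change resPairing b (Bang.incl b P η) (f * g) = LinearMap.mul' k k (TensorProduct.map
        ((resPairing b).flip f) ((resPairing b).flip g) (Coalgebra.comul (Bang.incl b P η)))
      rw [resPairing_incl, Bang.comul_incl, resPairingAt_apply, ← LC.comul_pairing,
        ← LinearMap.comp_apply (TensorProduct.map _ _) (TensorProduct.map _ _), ← TensorProduct.map_comp]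
      have h : ∀ f, (resPairing b).flip f ∘ₗ Bang.incl b P =
          res b P ∘ₗ Algebra.lsmul k k (LC b P) f :=
        fun f => LinearMap.ext fun η => congrArg (fun L => L f) (resPairing_incl b P η)
      rw [h, h])

theorem resAlgHom_apply (f : PolyRing k V) (ω : Bang b) :
    resAlgHom b f ω = resPairing b ω f := rfl

theorem dereliction_apply (ω : Bang b) :
    dereliction b ω = ∑ i, totalRes b (coordFn b i • ω) • b i := by
  have h : dereliction b = ∑ i, ((resPairing b).flip (coordFn b i)).smulRight (b i) := by
    refine Bang.hom_ext b fun P => LinearMap.ext fun η => ?_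
    rw [LinearMap.comp_apply, dereliction_incl]
    simp [derelictionAt, LinearMap.sum_apply, resPairing_incl, resPairingAt_apply]
  rw [h]
  simp [LinearMap.sum_apply, resPairing_apply]

/-- On linear forms the pairing sees exactly the dereliction; this turns the condition `d ∘ Φ = φ`
into one on the generators of `R`. -/
theorem resPairing_ι (ω : Bang b) (κ : Module.Dual k V) :
    resPairing b ω (SymmetricAlgebra.ι k _ κ) = κ (dereliction b ω) := by
  rw [coordFn_expand b, dereliction_apply, map_sum, map_sum]
  simp [resPairing_apply, mul_comm]

end Pairing

/-! ### The convolution algebra of `C` and the contraction. -/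

section Dual

variable {k : Type*} [Field k] {V : Type*} [AddCommGroup V] [Module k V]
  {C : Type*} [AddCommGroup C] [Module k C] [Coalgebra k C]

/-- Convolution multiplies functionals through `Δ`, so an `l`-fold convolution product is evaluated
through the iterated coproduct. -/
theorem pairingDual_iterComul (φ : C →ₗ[k] V) {l : ℕ} (κ : Fin l → Module.Dual k V) (η : C) :
    TensorPower.pairingDual k V l (PiTensorProduct.tprod k κ)
      (PiTensorProduct.map (fun _ => φ) (iterComul k C l η)) =
    (List.ofFn fun i => WithConv.toConv (κ i ∘ₗ φ)).prod η := by
  induction l generalizing η with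
  | zero =>
    rw [List.ofFn_zero, List.prod_nil, LinearMap.convOne_apply, iterComul, LinearMap.comp_apply,
      LinearEquiv.coe_coe, TensorPower.algebraMap₀_eq_smul_one, TensorPower.gOne_def]
    simp
  | succ l ih =>
    -- The recursion `Δ^l = (Δ^(l-1) ⊗ id) Δ` adds the new tensor factor on the right, so the last
    -- functional is the one split off.
    rw [List.ofFn_succ', List.concat_eq_append, List.prod_append, List.prod_singleton,
      LinearMap.convMul_apply]
    have h : TensorPower.pairingDual k V (l + 1) (PiTensorProduct.tprod k κ) ∘ₗ
        PiTensorProduct.map (fun _ => φ) ∘ₗ appendLast k C l =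
        LinearMap.mul' k k ∘ₗ TensorProduct.map (TensorPower.pairingDual k V l
          (PiTensorProduct.tprod k fun i => κ i.castSucc) ∘ₗ PiTensorProduct.map (fun _ => φ))
          (κ (Fin.last l) ∘ₗ φ) := by
      refine TensorProduct.ext (PiTensorProduct.ext (MultilinearMap.ext fun c =>
        LinearMap.ext fun d => ?_))
      simp [appendLast_tprod, Fin.prod_univ_castSucc]
    have h' : TensorPower.pairingDual k V l
          (PiTensorProduct.tprod k fun i => κ i.castSucc) ∘ₗ PiTensorProduct.map (fun _ => φ) ∘ₗ
            iterComul k C l =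
        (List.ofFn fun i : Fin l => WithConv.toConv (κ i.castSucc ∘ₗ φ)).prod.ofConv :=
      LinearMap.ext fun η => ih _ η
    refine (congrArg (fun L => L ((iterComul k C l).rTensor C (Coalgebra.comul η))) h).trans ?_
    rw [← h', ← LinearMap.comp_assoc, ← LinearMap.map_comp_rTensor (f' := iterComul k C l)]
    rfl

variable [Coalgebra.IsCocomm k C]

/-- The homomorphism from `R` to the convolution algebra of `C` induced by `φ : C → V`. -/
def convHom (φ : C →ₗ[k] V) : PolyRing k V →ₐ[k] WithConv (C →ₗ[k] k) :=
  SymmetricAlgebra.lift ((WithConv.linearEquiv k _).symm.toLinearMap ∘ₗ φ.dualMap)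

theorem convHom_ι (φ : C →ₗ[k] V) (κ : Module.Dual k V) :
    convHom φ (SymmetricAlgebra.ι k _ κ) = WithConv.toConv (κ ∘ₗ φ) := by
  simp [convHom]
  rfl

/-- Products of linear forms span `R`. On such a product the homomorphism gives the convolution
product of the `κ ∘ φ`, which is the contraction by `pairingDual_iterComul`. -/
theorem convHom_apply (φ : C →ₗ[k] V) (η : C) (f : PolyRing k V) :
    convHom φ f η = contract (powerSeq φ η) f := by
  obtain ⟨x, rfl⟩ := SymmetricAlgebra.algHom_surjective k (Module.Dual k V) f
  have hx : x ∈ Submodule.span k (Set.range fun A : List (Module.Dual k V) =>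
    (A.map (TensorAlgebra.ι k)).prod) := tensorAlgebra_span k (Module.Dual k V) ▸ trivial
  induction hx using Submodule.span_induction with
  | zero => simp
  | add x y _ _ hx hy => rw [map_add, map_add, map_add, ← hx, ← hy]; rfl
  | smul c x _ hx => rw [map_smul, map_smul, map_smul, ← hx]; rfl
  | mem x hx =>
    obtain ⟨A, rfl⟩ := hx
    rw [contract_algHom]
    have hA : List.ofFn (fun i : Fin A.length => A[i]) = A := List.ofFn_getElem
    have h1 := contractTensor_tprod (powerSeq φ η).1 (fun i : Fin A.length => A[i])
    have h2 := pairingDual_iterComul φ (fun i : Fin A.length => A[i]) η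
    have h3 : (List.ofFn fun i : Fin A.length => TensorAlgebra.ι k A[i]) =
        A.map (TensorAlgebra.ι k) := by
      conv_rhs => rw [← hA, List.map_ofFn]
      rfl
    have h4 : (List.ofFn fun i : Fin A.length => WithConv.toConv (A[i] ∘ₗ φ)) =
        A.map fun κ => WithConv.toConv (κ ∘ₗ φ) := by
      conv_rhs => rw [← hA, List.map_ofFn]
      rfl
    beta_reduce
    rw [← h3]
    refine Eq.trans ?_ h1.symm
    refine Eq.trans ?_ h2.symm
    rw [h3, h4, map_list_prod, map_list_prod, List.map_map, List.map_map]
    have h5 : (convHom φ : PolyRing k V → _) ∘ (SymmetricAlgebra.algHom k (Module.Dual k V)) ∘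
        (TensorAlgebra.ι k) = fun κ => WithConv.toConv (κ ∘ₗ φ) := funext (convHom_ι φ)
    rw [← h5]
    rfl

/-- The functional `f ↦ convHom φ f η` vanishes on an ideal of finite codimension. -/
theorem exists_ideal_convHom_eq_zero (φ : C →ₗ[k] V) (η : C) : ∃ I : Ideal (PolyRing k V),
    FiniteDimensional k (PolyRing k V ⧸ I) ∧ ∀ f ∈ I, convHom φ f η = 0 := by
  let r := Coalgebra.Repr.arbitrary k η
  -- The largest ideal on which the functional vanishes.
  let I : Ideal (PolyRing k V) :=
    { carrier := {f | ∀ g, convHom φ (f * g) η = 0}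
      zero_mem' := by simp
      add_mem' := fun {x y} hx hy g => by
        rw [add_mul, map_add]
        exact (congrArg₂ (· + ·) (hx g) (hy g)).trans (add_zero _)
      smul_mem' := fun c x hx g => by
        rw [smul_eq_mul, mul_comm c, mul_assoc]; exact hx _ }
  -- With `Δ η = ∑ left_i ⊗ right_i`, the value of `convHom φ (f * g)` at `η` is the sum of `convHom
  -- φ f left_i * convHom φ g right_i`. The finitely many conditions `convHom φ f left_i = 0`
  -- therefore force `f ∈ I`.
  let K : PolyRing k V →ₗ[k] (r.index → k) :=
    LinearMap.pi fun i => LinearMap.applyₗ (r.left i) ∘ₗ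
      (WithConv.linearEquiv k (C →ₗ[k] k)).toLinearMap ∘ₗ (convHom φ).toLinearMap
  refine ⟨I, finiteDimensional_quotient_of_ker_le I K fun f hf g => ?_,
    fun f hf => by simpa using hf 1⟩
  rw [map_mul, r.convMul_apply]
  refine Finset.sum_eq_zero fun i hi => ?_
  have h : convHom φ f (r.left i) = 0 := congrFun hf ⟨i, hi⟩
  rw [h, zero_mul]

end Dual

/-! ### The universal property. -/

section Cofree

variable {k : Type*} [Field k] {V : Type*} [AddCommGroup V] [Module k V]
  {n : ℕ} (b : Module.Basis (Fin n) k V)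
  {C : Type*} [AddCommGroup C] [Module k C] [Coalgebra k C] [Coalgebra.IsCocomm k C]

/-- Pulling functionals back along a coalgebra morphism respects convolution, so both sides are
algebra homomorphisms in `f`, and an algebra homomorphism on `Sym(V^*)` is determined by its values
on `V^*`. -/
theorem resPairing_of_dereliction_comp {φ : C →ₗ[k] V} (Φ : C →ₗc[k] Bang b)
    (hΦ : dereliction b ∘ₗ Φ.toLinearMap = φ) (η : C) (f : PolyRing k V) :
    resPairing b (Φ η) f = convHom φ f η := by
  let Ψ : PolyRing k V →ₐ[k] WithConv (C →ₗ[k] k) :=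
    AlgHom.ofLinearMap ((WithConv.linearEquiv k _).symm.toLinearMap ∘ₗ
      LinearMap.lcomp k k Φ.toLinearMap ∘ₗ (WithConv.linearEquiv k _).toLinearMap ∘ₗ
        (resAlgHom b).toLinearMap)
      (by
        refine WithConv.ext (LinearMap.ext fun η => ?_)
        change resAlgHom b 1 (Φ η) = _
        rw [map_one, LinearMap.convOne_apply, LinearMap.convOne_apply]
        exact congrArg _ (congrArg (fun L => L η) Φ.counit_comp))
      (fun f g => by
        refine WithConv.ext ?_
        change (resAlgHom b (f * g)).ofConv.comp Φ.toLinearMap = _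
        rw [map_mul, LinearMap.convMul_comp_coalgHom_distrib]
        rfl)
  have h : Ψ = convHom φ := by
    refine SymmetricAlgebra.algHom_ext (LinearMap.ext fun κ => ?_)
    refine Eq.trans ?_ (convHom_ι φ κ).symm
    refine WithConv.ext (LinearMap.ext fun η => ?_)
    refine (resPairing_ι b (Φ η) κ).trans ?_
    rw [← hΦ]
    rfl
  rw [← h]
  rfl

/-- Each `Φ(η)` is chosen to represent `f ↦ convHom φ f η`. Injectivity of the pairing makes the
choice linear in `η`; the unit, the products and the linear forms in `R` yield in turn the counit
law, the coproduct law and `d ∘ Φ = φ`. -/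
theorem exists_coalgHom [IsAlgClosed k] (φ : C →ₗ[k] V) :
    ∃ Φ : C →ₗc[k] Bang b, dereliction b ∘ₗ Φ.toLinearMap = φ := by
  have hex (η : C) : ∃ ω, ∀ f, resPairing b ω f = convHom φ f η := by
    obtain ⟨I, hI, h⟩ := exists_ideal_convHom_eq_zero φ η
    obtain ⟨ω, hω⟩ := exists_resPairing_eq b I (LinearMap.applyₗ η ∘ₗ
      (WithConv.linearEquiv k (C →ₗ[k] k)).toLinearMap ∘ₗ (convHom φ).toLinearMap) h
    exact ⟨ω, fun f => congrArg (fun L => L f) hω⟩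
  choose F hF using hex
  let L : C →ₗ[k] Bang b :=
    { toFun := F
      map_add' := fun x y => resPairing_injective b <| LinearMap.ext fun f => by
        simp [hF]
      map_smul' := fun c x => resPairing_injective b <| LinearMap.ext fun f => by
        simp [hF] }
  have hL : ∀ f, (resPairing b).flip f ∘ₗ L = (convHom φ f).ofConv :=
    fun f => LinearMap.ext fun η => hF η f
  have hsep : ∀ ω : Bang b, (∀ f, (resPairing b).flip f ω = 0) → ω = 0 := fun ω h =>
    resPairing_injective b <| LinearMap.ext fun f => (h f).trans (by simp)
  refine ⟨{ L with
    counit_comp := ?_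
    map_comp_comul := ?_ }, ?_⟩
  · ext η
    have h1 := hF η 1
    rw [map_one (convHom φ), LinearMap.convOne_apply, resPairing_apply, one_smul, ← counit_eq_totalRes] at h1
    exact h1
  · refine LinearMap.ext fun η => sub_eq_zero.1 ?_
    refine tmul_eq_zero_of_separating _ _ hsep hsep _ fun f g => ?_
    rw [map_sub, map_sub, sub_eq_zero]
    -- Pairing `Δ(L η)` with `f ⊗ g` is pairing `L η` with `f * g`, by multiplicativity of
    -- `resAlgHom`; the other side of the coproduct law is then multiplicativity of `convHom φ`.
    have h1 : LinearMap.mul' k k (TensorProduct.map ((resPairing b).flip f)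
        ((resPairing b).flip g) (Coalgebra.comul (L η))) = convHom φ (f * g) η := by
      rw [← hF, ← resAlgHom_apply, map_mul]; rfl
    refine Eq.trans ?_ h1.symm
    change LinearMap.mul' k k (TensorProduct.map ((resPairing b).flip f)
        ((resPairing b).flip g) (TensorProduct.map L L (Coalgebra.comul η))) = _
    rw [← LinearMap.comp_apply (TensorProduct.map _ _) (TensorProduct.map _ _), ← TensorProduct.map_comp, hL, hL, map_mul]
    rfl
  · refine LinearMap.ext fun η => ?_
    refine b.ext_elem fun i => ?_
    have h1 := (resPairing_ι b (F η) (b.coord i)).symm.trans (hF η _)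
    rw [convHom_ι] at h1
    exact h1

end Cofree

end CofreeCoalg

end

open CofreeCoalg in
theorem proposition2p15 {k : Type*} [Field k] [IsAlgClosed k] [CharZero k]
    {V : Type*} [AddCommGroup V] [Module k V] {n : ℕ} (b : Module.Basis (Fin n) k V)
    {C : Type*} [AddCommGroup C] [Module k C] [Coalgebra k C] [Coalgebra.IsCocomm k C]
    (φ : C →ₗ[k] V) :
    (∃! Φ : C →ₗc[k] Bang b, dereliction b ∘ₗ Φ.toLinearMap = φ) ∧
    ∀ Φ : C →ₗc[k] Bang b, dereliction b ∘ₗ Φ.toLinearMap = φ →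
      ∀ η : C,
        (∀ f : PolyRing k V, totalRes b (f • Φ η) = contract (powerSeq φ η) f) ∧
        ∀ ω : Bang b,
          (∀ f : PolyRing k V, totalRes b (f • ω) = contract (powerSeq φ η) f) → ω = Φ η := by
  -- For any lift `Φ` the residue formula characterises `Φ η`. As the formula depends only on `φ`
  -- and `η`, any two lifts coincide.
  have key : ∀ Φ : C →ₗc[k] Bang b, dereliction b ∘ₗ Φ.toLinearMap = φ → ∀ (η : C) (ω : Bang b),
      (∀ f : PolyRing k V, totalRes b (f • ω) = contract (powerSeq φ η) f) ↔ ω = Φ η := by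
    intro Φ hΦ η ω
    have h := resPairing_of_dereliction_comp b Φ hΦ η
    simp only [convHom_apply] at h
    refine ⟨fun hω => resPairing_injective b (LinearMap.ext fun f => (hω f).trans (h f).symm), ?_⟩
    rintro rfl
    exact h
  obtain ⟨Φ, hΦ⟩ := exists_coalgHom b φ
  exact ⟨⟨Φ, hΦ, fun Φ' hΦ' => CoalgHom.ext fun η =>
      (key Φ hΦ η _).1 ((key Φ' hΦ' η _).2 rfl)⟩,
    fun Φ hΦ η => ⟨(key Φ hΦ η _).2 rfl, fun ω => (key Φ hΦ η ω).1⟩⟩
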